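/- Let $F$ be a finite field and let $L$ be an extension field of $F$ (of finite or infinite degree). An $F$-linear subspace $A\subseteq L$ is called a Sidon space if $\dim_F(A\cap xA)\le 1$ for every $x\in L\setminus F$, where $xA=\{xa : a\in A\}$. Let $A^2$ denote the $F$-linear span of the products $ab$ with $a,b\in A$. If $A$ is a Sidon space of finite dimension $\dim_F(A)\ge 3$, then $$\dim_F(A^2) > 2\dim_F(A)-1.$$ -/

import Mathlib

/-- An `F`-subspace `A` of an extension field `L` of `F` is a *Sidon space* if
`dim_F (A ∩ xA) ≤ 1` for every `x ∈ L \ F`, where `xA = {x * a | a ∈ A}`. -/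
def IsSidonSpace {F L : Type*} [Field F] [Field L] [Algebra F L] (A : Submodule F L) : Prop :=
  ∀ x : L, x ∉ Set.range (algebraMap F L) →
    Module.rank F ↥(A ⊓ A.map (LinearMap.mulLeft F x)) ≤ 1

/-! Put `k = dim A`, `q = |F|`. The Sidon condition gives `dim (aA ∩ cA) ≤ 1` for independent `a`,
`c` in `A`, so `dim A² ≥ 2k - 1`, and it remains to exclude equality. Under equality `aA + cA = A²`,
hence for every nonzero functional `φ` on `A²` the form `φ(xy)` has radical of dimension at most 1
(`finrank_ker_compr₂_le`). Restrict to a subspace `B` of odd dimension `n` and codimension at most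
1; radicals then have dimension at most 2. A form of odd rank has exactly `q ^ (n - 1)` isotropic
vectors (`card_isotropic_of_odd`), so only forms with radical a line have a nonzero isotropic
excess. Sum the excess over pairs `(b, φ)` with `b ≠ 0` in the radical of `φ ≠ 0`
(`isotropicExcess_double_count`). Each relevant `φ` is met `q - 1` times. For fixed `b`, the sum
depends only on the number of `x` with `x² ∈ bB`, and the Sidon condition leaves only the multiples
of `b`. The resulting identity in powers of `q` fails. -/

open Module

/-! ### Isotropic vectors of symmetric bilinear forms over finite fields -/

/-! ### Diagonal quadratic equations in odd characteristic. -/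

section OddCharacteristic

variable {F : Type*} [Field F] [Fintype F] [DecidableEq F]

theorem sum_comp_sq (hF : ringChar F ≠ 2) (g : F → ℤ) :
    ∑ y : F, g (y ^ 2) = ∑ z : F, g z * (1 + quadraticChar F z) := by
  have h := Finset.sum_fiberwise (Finset.univ : Finset F) (fun y => y ^ 2) (fun y => g (y ^ 2))
  rw [← h]
  refine Finset.sum_congr rfl fun z _ => ?_
  have hz := quadraticChar_card_sqrts hF z
  rw [Finset.sum_congr rfl (g := fun _ => g z)
    (fun y hy => by rw [(Finset.mem_filter.1 hy).2]), Finset.sum_const, nsmul_eq_mul, mul_comm,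
    add_comm (1 : ℤ), ← hz]
  congr 3
  ext y
  simp

/-- For `c ≠ 0`, scaling by `c` gives the Jacobi sum of the quadratic character with its inverse,
itself. For `c = 0`, every nonzero `w` contributes the same sign. -/
theorem sum_quadraticChar_mul_sub (hF : ringChar F ≠ 2) (c : F) :
    ∑ w : F, quadraticChar F w * quadraticChar F (c - w) =
      quadraticChar F (-1) * (Fintype.card F * (if c = 0 then 1 else 0) - 1) := by
  by_cases hc : c = 0
  · subst hc
    have h : ∀ w : F, quadraticChar F w * quadraticChar F (0 - w) =
        quadraticChar F (-1) * (1 - if w = 0 then 1 else 0) := by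
      intro w
      by_cases hw : w = 0
      · simp [hw]
      · rw [zero_sub, neg_eq_neg_one_mul, map_mul, mul_left_comm, ← sq, quadraticChar_sq_one hw]
        simp [hw]
    simp only [h, ← Finset.mul_sum]
    simp
  · have h := jacobiSum_nontrivial_inv (quadraticChar_ne_one hF)
    rw [(quadraticChar_isQuadratic F).inv] at h
    rw [← Equiv.sum_comp (Equiv.mulLeft₀ c hc)]
    have h2 : ∀ v : F, quadraticChar F (Equiv.mulLeft₀ c hc v) *
        quadraticChar F (c - Equiv.mulLeft₀ c hc v) =
        quadraticChar F v * quadraticChar F (1 - v) := by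
      intro v
      have : c - c * v = c * (1 - v) := by ring
      simp only [Equiv.mulLeft₀_apply, this, map_mul]
      linear_combination quadraticChar F v * quadraticChar F (1 - v) * quadraticChar_sq_one hc
    simp only [h2]
    rw [jacobiSum] at h
    rw [h]
    simp [hc]

theorem sum_quadraticChar_sub_mul_sq (hF : ringChar F ≠ 2) {a : F} (ha : a ≠ 0) (c : F) :
    ∑ y : F, quadraticChar F (c - a * y ^ 2) =
      quadraticChar F (-a) * (Fintype.card F * (if c = 0 then 1 else 0) - 1) := by
  rw [sum_comp_sq hF (fun z => quadraticChar F (c - a * z)),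
    ← Equiv.sum_comp (Equiv.mulLeft₀ a⁻¹ (inv_ne_zero ha))]
  have h : ∀ w : F, quadraticChar F (c - a * (Equiv.mulLeft₀ a⁻¹ (inv_ne_zero ha) w)) *
      (1 + quadraticChar F (Equiv.mulLeft₀ a⁻¹ (inv_ne_zero ha) w)) =
      quadraticChar F (c - w) +
        quadraticChar F a * (quadraticChar F w * quadraticChar F (c - w)) := by
    intro w
    have hi : quadraticChar F a⁻¹ = quadraticChar F a := by
      have h1 : quadraticChar F a⁻¹ * quadraticChar F a = 1 := by
        rw [← map_mul, inv_mul_cancel₀ ha, map_one]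
      linear_combination quadraticChar F a * h1 - quadraticChar F a⁻¹ * quadraticChar_sq_one ha
    simp only [Equiv.mulLeft₀_apply, map_mul, hi, mul_inv_cancel_left₀ ha]
    ring
  simp only [h, Finset.sum_add_distrib, ← Finset.mul_sum]
  have h0 : ∑ x : F, quadraticChar F (c - x) = 0 := by
    rw [← quadraticChar_sum_zero hF]
    exact Equiv.sum_comp (Equiv.subLeft c) fun x => quadraticChar F x
  rw [sum_quadraticChar_mul_sub hF, h0, ← neg_one_mul a, map_mul]
  ring

theorem sum_indicator_sub_mul_sq (hF : ringChar F ≠ 2) {a : F} (ha : a ≠ 0) (c : F) :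
    ∑ y : F, (if c - a * y ^ 2 = 0 then (1 : ℤ) else 0) =
      1 + quadraticChar F a * quadraticChar F c := by
  rw [sum_comp_sq hF (fun z => if c - a * z = 0 then (1 : ℤ) else 0)]
  have h : ∀ z, c - a * z = 0 ↔ z = a * c * (a⁻¹) ^ 2 := by
    intro z
    rw [sub_eq_zero]
    constructor
    · rintro rfl
      field_simp
    · rintro rfl
      field_simp
  simp only [h, ite_mul, one_mul, zero_mul, Finset.sum_ite_eq', Finset.mem_univ, if_true,
    map_mul, map_pow, quadraticChar_sq_one (inv_ne_zero ha), mul_one]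

/-- The number of solutions of the diagonal equation `∑ i, a i * x i ^ 2 = c`. -/
def diagonalCount {n : ℕ} (a : Fin n → F) (c : F) : ℤ :=
  ∑ x : Fin n → F, if ∑ i, a i * x i ^ 2 = c then 1 else 0

theorem diagonalCount_cons {n : ℕ} (a : Fin (n + 1) → F) (c : F) :
    diagonalCount a c = ∑ y : F, diagonalCount (Fin.tail a) (c - a 0 * y ^ 2) := by
  unfold diagonalCount
  rw [← Equiv.sum_comp (Fin.consEquiv fun _ : Fin (n + 1) => F), Fintype.sum_prod_type]
  refine Finset.sum_congr rfl fun y _ => Finset.sum_congr rfl fun x _ => ?_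
  simp [Fin.sum_univ_succ, Fin.consEquiv, Fin.tail, eq_sub_iff_add_eq']

/-- Induction on the variables: a zero coefficient multiplies the count by `q`, while a nonzero one
exchanges the two shapes through the character sums above. The value of `β` is immaterial: in the
odd case at `c = 0` its term vanishes. -/
theorem diagonalCount_eq (hF : ringChar F ≠ 2) {n : ℕ} (a : Fin n → F) :
    (Even (Finset.univ.filter fun i => a i ≠ 0).card ∧ ∃ β : ℤ, ∀ c,
      diagonalCount a c * Fintype.card F =
        Fintype.card F ^ n + β * (Fintype.card F * (if c = 0 then 1 else 0) - 1)) ∨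
    (Odd (Finset.univ.filter fun i => a i ≠ 0).card ∧ ∃ β : ℤ, ∀ c,
      diagonalCount a c * Fintype.card F =
        Fintype.card F ^ n + β * quadraticChar F c) := by
  induction n with
  | zero =>
    left
    refine ⟨by simp, 1, fun c => ?_⟩
    simp [diagonalCount, mul_comm, eq_comm]
  | succ n ih =>
    have hcard : (Finset.univ.filter fun i => a i ≠ 0).card =
        (if a 0 ≠ 0 then 1 else 0) + (Finset.univ.filter fun i => Fin.tail a i ≠ 0).card := by
      rw [Fin.card_filter_univ_succ]
      split_ifs <;> (simp [Fin.tail, add_comm]; congr!)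
    by_cases h0 : a 0 = 0
    · have hc : ∀ c, diagonalCount a c = Fintype.card F * diagonalCount (Fin.tail a) c := by
        intro c
        simp [diagonalCount_cons, h0]
      rw [hcard]
      simp only [h0, ne_eq, not_true_eq_false, if_false, zero_add]
      rcases ih (Fin.tail a) with ⟨hp, β, hβ⟩ | ⟨hp, β, hβ⟩
      · refine Or.inl ⟨hp, β * Fintype.card F, fun c => ?_⟩
        rw [hc, mul_assoc, hβ]
        ring
      · refine Or.inr ⟨hp, β * Fintype.card F, fun c => ?_⟩
        rw [hc, mul_assoc, hβ]
        ring
    · rw [hcard]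
      simp only [h0, ne_eq, not_false_eq_true, if_true]
      rcases ih (Fin.tail a) with ⟨hp, β, hβ⟩ | ⟨hp, β, hβ⟩
      · refine Or.inr ⟨hp.one_add, β * Fintype.card F * quadraticChar F (a 0), fun c => ?_⟩
        rw [diagonalCount_cons, Finset.sum_mul]
        simp only [hβ, Finset.sum_add_distrib, ← Finset.mul_sum, Finset.sum_sub_distrib,
          sum_indicator_sub_mul_sq hF h0]
        simp
        ring
      · refine Or.inl ⟨hp.one_add, β * quadraticChar F (-a 0), fun c => ?_⟩
        rw [diagonalCount_cons, Finset.sum_mul]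
        simp only [hβ, Finset.sum_add_distrib, ← Finset.mul_sum,
          sum_quadraticChar_sub_mul_sq hF h0]
        simp
        ring

end OddCharacteristic

/-! ### Alternating forms have even rank. -/

section Alternating

variable {K : Type*} [Field K]

/-- A nonzero form has a nondegenerate plane `W`; passing to its orthogonal complement lowers the
dimension by 2 and keeps the radical. -/
theorem LinearMap.BilinForm.even_finrank_add_finrank_ker_of_isAlt {V : Type*} [AddCommGroup V]
    [Module K V] [FiniteDimensional K V] (φ : LinearMap.BilinForm K V) (hφ : φ.IsAlt) :
    Even (finrank K V + finrank K (LinearMap.ker φ)) := by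
  induction h : finrank K V using Nat.strong_induction_on generalizing V with
  | _ d ih =>
  subst h
  by_cases h0 : φ = 0
  · subst h0
    rw [LinearMap.ker_zero, finrank_top]
    exact ⟨_, rfl⟩
  · obtain ⟨x, y, hxy⟩ : ∃ x y, φ x y ≠ 0 := by
      by_contra! h
      exact h0 (LinearMap.ext₂ h)
    have hyx : φ y x ≠ 0 := by
      rw [← hφ.neg_eq x y]
      exact neg_ne_zero.2 hxy
    have hrefl : φ.IsRefl := hφ.isRefl
    set W := Submodule.span K {x, y} with hW
    have hmem : ∀ z, z ∈ φ.orthogonal W ↔ φ x z = 0 ∧ φ y z = 0 := by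
      intro z
      rw [LinearMap.BilinForm.mem_orthogonal_iff]
      constructor
      · intro h
        exact ⟨h x (Submodule.subset_span (by simp)), h y (Submodule.subset_span (by simp))⟩
      · rintro ⟨h1, h2⟩ n hn
        obtain ⟨s, t, rfl⟩ := Submodule.mem_span_pair.1 hn
        simp [h1, h2]
    have hdisj : Disjoint W (φ.orthogonal W) := by
      rw [Submodule.disjoint_def]
      intro z hz hz'
      obtain ⟨s, t, rfl⟩ := Submodule.mem_span_pair.1 hz
      obtain ⟨h1, h2⟩ := (hmem _).1 hz'
      have h3 : t = 0 := by simpa [hφ x, hxy] using h1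
      have h4 : s = 0 := by simpa [hφ y, hyx] using h2
      simp [h3, h4]
    have hcompl : IsCompl W (φ.orthogonal W) :=
      (LinearMap.BilinForm.isCompl_orthogonal_iff_disjoint hrefl).2 hdisj
    have hWdim : finrank K W = 2 := by
      have hli : LinearIndependent K ![x, y] := by
        rw [LinearIndependent.pair_iff]
        intro s t hst
        have h1 : φ x (s • x + t • y) = 0 := by rw [hst, map_zero]
        have h2 : φ y (s • x + t • y) = 0 := by rw [hst, map_zero]
        exact ⟨by simpa [hφ y, hyx] using h2, by simpa [hφ x, hxy] using h1⟩
      have h := finrank_span_eq_card hli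
      rwa [Matrix.range_cons_cons_empty, Fintype.card_fin] at h
    have hsum := Submodule.finrank_add_eq_of_isCompl hcompl
    have hlt : finrank K (φ.orthogonal W) < finrank K V := by omega
    have hker : (LinearMap.ker (φ.restrict (φ.orthogonal W))).map (φ.orthogonal W).subtype =
        LinearMap.ker φ := by
      ext z
      simp only [Submodule.mem_map, LinearMap.mem_ker, Submodule.subtype_apply]
      constructor
      · rintro ⟨u, hu, rfl⟩
        ext v
        obtain ⟨w, hw, w', hw', rfl⟩ := Submodule.mem_sup.1
          (hcompl.sup_eq_top ▸ Submodule.mem_top : v ∈ W ⊔ φ.orthogonal W)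
        have h1 : φ u w = 0 := hrefl _ _ (u.2 w hw)
        have h2 : φ u w' = 0 := LinearMap.congr_fun hu ⟨w', hw'⟩
        simp [h1, h2]
      · intro hz
        have hz' : ∀ v, φ z v = 0 := fun v => LinearMap.congr_fun hz v
        refine ⟨⟨z, (hmem z).2 ⟨hrefl _ _ (hz' x), hrefl _ _ (hz' y)⟩⟩, ?_, rfl⟩
        ext v
        exact hz' v
    have hrec := ih _ hlt (φ.restrict (φ.orthogonal W)) (fun u => hφ u) rfl
    rw [← hker, (Submodule.equivMapOfInjective _ (Submodule.injective_subtype _) _).finrank_eq.symm, ← hsum, hWdim, add_assoc]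
    exact even_two.add hrec

end Alternating

theorem AddMonoidHom.card_ker_mul_card_of_surjective {G H : Type*} [AddCommGroup G]
    [AddCommGroup H] (f : G →+ H) (hf : Function.Surjective f) :
    Nat.card f.ker * Nat.card H = Nat.card G := by
  rw [f.ker.card_eq_card_quotient_mul_card_addSubgroup,
    Nat.card_congr (QuotientAddGroup.quotientKerEquivOfSurjective f hf).toEquiv, mul_comm]

/-! ### Isotropic vectors of forms of odd rank. -/

section Count

variable {F V : Type*} [Field F] [Finite F] [AddCommGroup V] [Module F V]

/-- In characteristic 2 the map `x ↦ φ x x` is additive, and it is onto because it is nonzero and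
every scalar is a square. -/
theorem card_isotropic_of_charP_two [FiniteDimensional F V] [CharP F 2]
    (φ : LinearMap.BilinForm F V) (hφ : ∀ x y, φ x y = φ y x)
    (halt : ¬ φ.IsAlt) :
    Nat.card {x : V // φ x x = 0} * Nat.card F = Nat.card F ^ finrank F V := by
  let f : V →+ F :=
    { toFun := fun x => φ x x
      map_zero' := by simp
      map_add' := fun x y => by
        simp only [map_add, LinearMap.add_apply, hφ x y]
        linear_combination CharTwo.add_self_eq_zero (φ y x) }
  have hsurj : Function.Surjective f := by
    intro c
    obtain ⟨x, hx⟩ : ∃ x, φ x x ≠ 0 := by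
      by_contra! h
      exact halt h
    obtain ⟨r, hr⟩ := FiniteField.isSquare_of_char_two (ringChar.eq F 2) (c / φ x x)
    refine ⟨r • x, ?_⟩
    change φ (r • x) (r • x) = c
    simp only [map_smul, LinearMap.smul_apply, smul_eq_mul]
    rw [← mul_assoc, ← hr, div_mul_cancel₀ _ hx]
  rw [← Module.natCard_eq_pow_finrank (K := F) (V := V), ← f.card_ker_mul_card_of_surjective hsurj]
  rfl

theorem card_isotropic_of_ringChar_ne_two [FiniteDimensional F V]
    (hF : ringChar F ≠ 2) (φ : LinearMap.BilinForm F V)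
    (hφ : ∀ x y, φ x y = φ y x) (hodd : Odd (finrank F V + finrank F (LinearMap.ker φ))) :
    Nat.card {x : V // φ x x = 0} * Nat.card F = Nat.card F ^ finrank F V := by
  classical
  have := Fintype.ofFinite F
  have := invertibleOfNonzero (Ring.two_ne_zero hF)
  obtain ⟨v, hv⟩ := LinearMap.BilinForm.exists_orthogonal_basis (B := φ) ⟨hφ⟩
  set a : Fin (finrank F V) → F := fun i => φ (v i) (v i) with ha
  -- The number of nonzero diagonal entries is the rank, which selects the odd case of
  -- `diagonalCount_eq`.
  have hrank : (Finset.univ.filter fun i => a i ≠ 0).card + finrank F (LinearMap.ker φ) =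
      finrank F V := by
    have hM : LinearMap.toMatrix v v.dualBasis φ = Matrix.diagonal a := by
      ext i j
      rw [LinearMap.toMatrix_apply, Basis.dualBasis_repr, Matrix.diagonal_apply]
      split_ifs with hij
      · subst hij
        rfl
      · exact hv (Ne.symm hij)
    have h1 := Matrix.rank_diagonal a
    rw [← hM, Matrix.rank_eq_finrank_range_toLin _ v.dualBasis v, Matrix.toLin_toMatrix,
      Fintype.card_subtype] at h1
    rw [← h1, LinearMap.finrank_range_add_finrank_ker]
  have hcount : (Nat.card {x : V // φ x x = 0} : ℤ) = diagonalCount a 0 := by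
    rw [diagonalCount, Finset.sum_boole, ← Fintype.card_subtype, Nat.card_eq_fintype_card.symm]
    congr 1
    refine Nat.card_congr (v.equivFun.toEquiv.subtypeEquiv fun x => ?_)
    have hx := v.sum_equivFun x
    have hsum : φ x x = ∑ i, a i * v.equivFun x i ^ 2 := by
      conv_lhs => rw [← hx]
      rw [map_sum]
      refine Finset.sum_congr rfl fun i _ => ?_
      rw [map_sum, LinearMap.sum_apply, Finset.sum_eq_single i]
      · simp only [ha, map_smul, LinearMap.smul_apply, smul_eq_mul]
        ring
      · intro j _ hj
        rw [map_smul, map_smul, LinearMap.smul_apply, show φ (v j) (v i) = 0 from hv hj,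
          smul_zero, smul_zero]
      · simp
    rw [hsum]
    rfl
  rcases diagonalCount_eq hF a with ⟨hp, -⟩ | ⟨-, β, hβ⟩
  · rw [← hrank, add_assoc] at hodd
    exact absurd hodd (Nat.not_odd_iff_even.2 (hp.add ⟨_, rfl⟩))
  · have h := hβ 0
    rw [← hcount] at h
    rw [Nat.card_eq_fintype_card (α := F)]
    simp at h
    exact_mod_cast h

/-- A symmetric bilinear form of odd rank on a finite-dimensional space `V` over a field with `q`
elements has exactly `q ^ (dim V - 1)` isotropic vectors. -/
theorem card_isotropic_of_odd [FiniteDimensional F V] (φ : LinearMap.BilinForm F V)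
    (hφ : ∀ x y, φ x y = φ y x) (hodd : Odd (finrank F V + finrank F (LinearMap.ker φ))) :
    Nat.card {x : V // φ x x = 0} * Nat.card F = Nat.card F ^ finrank F V := by
  by_cases hF : ringChar F = 2
  · have : CharP F 2 := ringChar.of_eq hF
    exact card_isotropic_of_charP_two φ hφ fun halt =>
      Nat.not_even_iff_odd.2 hodd (φ.even_finrank_add_finrank_ker_of_isAlt halt)
  · exact card_isotropic_of_ringChar_ne_two hF φ hφ hodd

end Count

/-! ### Double counting with isotropic excess. -/

section DoubleCount

variable {F E P : Type*} [Field F] [Finite F] [AddCommGroup E] [Module F E]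
  [FiniteDimensional F E] [AddCommGroup P] [Module F P] [FiniteDimensional F P]

omit [Finite F] [FiniteDimensional F P] in
theorem card_dualAnnihilator_apply_eq_zero (U : Submodule F P) {p : P} (hp : p ∉ U) :
    Nat.card {φ : U.dualAnnihilator // φ.1 p = 0} * Nat.card F = Nat.card U.dualAnnihilator := by
  obtain ⟨f, hf, hfU⟩ := U.exists_le_ker_of_notMem hp
  let g : U.dualAnnihilator →ₗ[F] F := (Dual.eval F P p).comp U.dualAnnihilator.subtype
  have hsurj : Function.Surjective g := by
    have hfm : f ∈ U.dualAnnihilator := (Submodule.mem_dualAnnihilator f).2 fun w hw => hfU hw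
    intro c
    refine ⟨(c / f p) • ⟨f, hfm⟩, ?_⟩
    change (c / f p) * f p = c
    exact div_mul_cancel₀ _ hf
  exact AddMonoidHom.card_ker_mul_card_of_surjective (G := U.dualAnnihilator) (H := F)
    g.toAddMonoidHom hsurj

/-- The deviation of the number of isotropic vectors of `φ ∘ μ` from its expected value,
scaled by the cardinality of the field. -/
noncomputable def isotropicExcess (μ : E →ₗ[F] E →ₗ[F] P) (φ : Dual F P) : ℤ :=
  Nat.card F * Nat.card {x : E // φ (μ x x) = 0} - Nat.card E

-- Exchange the sums: if `μ x x ∈ U`, every `φ` in the annihilator kills it; otherwise a fraction `1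
-- / q` does, which the term `- Nat.card E` cancels exactly.
omit [FiniteDimensional F P] in
open Classical in
theorem sum_isotropicExcess_dualAnnihilator [Fintype (Dual F P)] (μ : E →ₗ[F] E →ₗ[F] P)
    (U : Submodule F P) :
    ∑ φ : Dual F P with φ ∈ U.dualAnnihilator, isotropicExcess μ φ =
      Nat.card U.dualAnnihilator * (Nat.card F - 1) * Nat.card {x : E // μ x x ∈ U} := by
  have : Finite E := Module.finite_of_finite F
  have := Fintype.ofFinite E
  have hann : (Nat.card U.dualAnnihilator : ℤ) =
      ∑ φ : Dual F P with φ ∈ U.dualAnnihilator, 1 := by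
    rw [Finset.sum_const, nsmul_one, ← Fintype.card_subtype, ← Nat.card_eq_fintype_card]
  have hx : ∀ x : E, (Nat.card F : ℤ) * ∑ φ : Dual F P with φ ∈ U.dualAnnihilator,
      (if φ (μ x x) = 0 then 1 else 0) = Nat.card U.dualAnnihilator +
        Nat.card U.dualAnnihilator * (Nat.card F - 1) * (if μ x x ∈ U then 1 else 0) := by
    intro x
    by_cases hxU : μ x x ∈ U
    · rw [Finset.sum_congr rfl (g := fun _ => (1 : ℤ)), ← hann, if_pos hxU]
      · ring
      · intro φ hφ
        rw [if_pos ((Submodule.mem_dualAnnihilator φ).1 (Finset.mem_filter.1 hφ).2 _ hxU)]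
    · have h := card_dualAnnihilator_apply_eq_zero U hxU
      rw [if_neg hxU, mul_zero, add_zero, ← h, Finset.sum_boole, Finset.filter_filter,
        ← Fintype.card_subtype, ← Nat.card_eq_fintype_card,
        ← Nat.card_congr (Equiv.subtypeSubtypeEquivSubtypeInter (fun φ => φ ∈ U.dualAnnihilator)
          fun φ : Dual F P => φ (μ x x) = 0)]
      push_cast
      ring
  have hcard : ∀ φ : Dual F P, (Nat.card {x : E // φ (μ x x) = 0} : ℤ) =
      ∑ x : E, if φ (μ x x) = 0 then 1 else 0 := by
    intro φ
    rw [Finset.sum_boole, ← Fintype.card_subtype, ← Nat.card_eq_fintype_card]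
  have hU : (Nat.card {x : E // μ x x ∈ U} : ℤ) = ∑ x : E, if μ x x ∈ U then 1 else 0 := by
    rw [Finset.sum_boole, ← Fintype.card_subtype, ← Nat.card_eq_fintype_card]
  simp only [isotropicExcess, hcard, Finset.sum_sub_distrib, ← Finset.mul_sum]
  rw [Finset.sum_comm, Finset.mul_sum, Finset.sum_congr rfl fun x _ => hx x,
    Finset.sum_add_distrib, ← Finset.mul_sum, ← hU]
  rw [Finset.sum_const, Finset.sum_const, Finset.card_univ, ← Nat.card_eq_fintype_card,
    nsmul_eq_mul, nsmul_eq_mul]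
  rw [Finset.sum_const, nsmul_one] at hann
  rw [hann]
  ring

omit [Finite F] [FiniteDimensional F E] [FiniteDimensional F P] in
theorem isotropicExcess_zero (μ : E →ₗ[F] E →ₗ[F] P) :
    isotropicExcess μ (0 : Dual F P) = (Nat.card F - 1) * Nat.card E := by
  have h : Nat.card {x : E // (0 : Dual F P) (μ x x) = 0} = Nat.card E :=
    Nat.card_congr (Equiv.subtypeUnivEquiv fun _ => rfl)
  rw [isotropicExcess, h]
  ring

/-- Double counting of the pairs `(b, φ)` with `φ ∘ μ b = 0`, weighted by `isotropicExcess`. -/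
theorem isotropicExcess_double_count (μ : E →ₗ[F] E →ₗ[F] P)
    (hsymm : ∀ x y, μ x y = μ y x)
    (hinj : ∀ a, a ≠ 0 → Function.Injective (μ a))
    (hsq : ∀ b x, x ∉ Submodule.span F {b} → ∀ c, μ x x ≠ μ b c)
    (hodd : Odd (finrank F E))
    (hker : ∀ φ : Dual F P, φ ≠ 0 → finrank F (LinearMap.ker (μ.compr₂ φ)) ≤ 2)
    {s : ℕ} (hs : finrank F P = finrank F E + s) :
    ((Nat.card F : ℤ) ^ finrank F E - 1) *
        ((Nat.card F : ℤ) ^ (s + 1) - (Nat.card F : ℤ) ^ finrank F E) =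
      (Nat.card F - 1) *
        ((Nat.card F : ℤ) ^ (finrank F E + s) - (Nat.card F : ℤ) ^ finrank F E) := by
  classical
  have : Finite E := Module.finite_of_finite F
  have : Finite (Dual F P) := Module.finite_of_finite F
  have := Fintype.ofFinite E
  have := Fintype.ofFinite (Dual F P)
  have hq : (Nat.card F : ℤ) - 1 ≠ 0 := by
    have := Finite.one_lt_card (α := F)
    omega
  have hE : Nat.card E = Nat.card F ^ finrank F E := Module.natCard_eq_pow_finrank
  have hremove : ∀ U : Submodule F P,
      ∑ φ : Dual F P with φ ≠ 0 ∧ φ ∈ U.dualAnnihilator, isotropicExcess μ φ =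
      (Nat.card F - 1) * (Nat.card U.dualAnnihilator * Nat.card {x : E // μ x x ∈ U} -
        Nat.card E) := by
    intro U
    have h := sum_isotropicExcess_dualAnnihilator μ U
    rw [← Finset.add_sum_erase _ _ (a := (0 : Dual F P)) (by simp), isotropicExcess_zero] at h
    rw [show (Finset.univ.filter fun φ : Dual F P => φ ≠ 0 ∧ φ ∈ U.dualAnnihilator) =
      (Finset.univ.filter fun φ => φ ∈ U.dualAnnihilator).erase 0 by ext; simp]
    linear_combination h
  have hall : ∑ φ : Dual F P with φ ≠ 0, isotropicExcess μ φ =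
      (Nat.card F - 1) *
        ((Nat.card F : ℤ) ^ (finrank F E + s) - (Nat.card F : ℤ) ^ finrank F E) := by
    have h := hremove ⊥
    have h1 : Nat.card {x : E // μ x x ∈ (⊥ : Submodule F P)} = 1 := by
      rw [Nat.card_eq_one_iff_unique]
      refine ⟨⟨fun x y => ?_⟩, ⟨⟨0, by simp⟩⟩⟩
      have hz : ∀ x : E, μ x x ∈ (⊥ : Submodule F P) → x = 0 := by
        intro x hx
        by_contra h0
        exact h0 (hinj x h0 (((Submodule.mem_bot F).1 hx).trans (map_zero _).symm))
      exact Subtype.ext ((hz _ x.2).trans (hz _ y.2).symm)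
    have h2 : Nat.card (⊥ : Submodule F P).dualAnnihilator =
        Nat.card F ^ (finrank F E + s) := by
      rw [Module.natCard_eq_pow_finrank (K := F), Submodule.dualAnnihilator_bot, finrank_top,
        Subspace.dual_finrank_eq, hs]
    rw [h1, h2, hE] at h
    simpa using h
  have hb : ∀ b : E, b ≠ 0 →
      ∑ φ : Dual F P with φ ≠ 0 ∧ φ ∈ (LinearMap.range (μ b)).dualAnnihilator,
        isotropicExcess μ φ = (Nat.card F - 1) *
          ((Nat.card F : ℤ) ^ (s + 1) - (Nat.card F : ℤ) ^ finrank F E) := by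
    intro b hb0
    rw [hremove]
    -- By `hsq`, only the `q` multiples of `b` have their square in the range of `μ b`.
    have h1 : Nat.card {x : E // μ x x ∈ LinearMap.range (μ b)} = Nat.card F := by
      have : Nat.card (Submodule.span F {b}) = Nat.card F := by
        rw [Module.natCard_eq_pow_finrank (K := F), finrank_span_singleton hb0, pow_one]
      rw [← this]
      refine Nat.card_congr (Equiv.subtypeEquivRight fun x => ?_)
      constructor
      · rintro ⟨c, hc⟩
        by_contra hx
        exact hsq b x hx c hc.symm
      · intro hx
        obtain ⟨t, rfl⟩ := Submodule.mem_span_singleton.1 hx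
        exact ⟨t • t • b, by simp⟩
    have h2 : Nat.card (LinearMap.range (μ b)).dualAnnihilator = Nat.card F ^ s := by
      have h3 := Subspace.finrank_add_finrank_dualAnnihilator_eq (LinearMap.range (μ b))
      rw [LinearMap.finrank_range_of_inj (hinj b hb0), hs] at h3
      rw [Module.natCard_eq_pow_finrank (K := F), Nat.add_left_cancel h3]
    rw [h1, h2, hE]
    push_cast
    ring
  have hker_card : ∀ φ : Dual F P, φ ≠ 0 →
      ∑ b : E with b ≠ 0, (if φ ∈ (LinearMap.range (μ b)).dualAnnihilator
        then isotropicExcess μ φ else 0) = (Nat.card F - 1) * isotropicExcess μ φ := by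
    intro φ hφ
    by_cases hD : isotropicExcess μ φ = 0
    · simp [hD]
    -- A nonzero excess forces even rank; since `dim E` is odd, the radical has odd dimension, at
    -- most 2.
    · have hr : finrank F (LinearMap.ker (μ.compr₂ φ)) = 1 := by
        have hnot : ¬ Odd (finrank F E + finrank F (LinearMap.ker (μ.compr₂ φ))) := by
          intro ho
          have h := card_isotropic_of_odd (μ.compr₂ φ)
            (fun x y => by simp [LinearMap.compr₂_apply, hsymm x y]) ho
          apply hD
          rw [isotropicExcess, hE, ← h]
          simp only [LinearMap.compr₂_apply]
          push_cast
          ring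
        have h2 := hker φ hφ
        rw [Nat.not_odd_iff_even, Nat.even_add'] at hnot
        obtain ⟨t, ht⟩ := hnot.1 hodd
        omega
      have hmem : ∀ b : E, φ ∈ (LinearMap.range (μ b)).dualAnnihilator ↔
          b ∈ LinearMap.ker (μ.compr₂ φ) := by
        intro b
        rw [Submodule.mem_dualAnnihilator, LinearMap.mem_ker, LinearMap.ext_iff]
        simp
      have hcard : (Finset.univ.filter fun b => b ∈ LinearMap.ker (μ.compr₂ φ)).card =
          Nat.card F := by
        rw [← Fintype.card_subtype, ← Nat.card_eq_fintype_card]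
        exact (Module.natCard_eq_pow_finrank (K := F)
          (V := LinearMap.ker (μ.compr₂ φ))).trans (by rw [hr, pow_one])
      rw [← Finset.sum_filter, Finset.sum_const, Finset.filter_filter]
      simp only [hmem]
      rw [show (Finset.univ.filter fun b => b ≠ 0 ∧ b ∈ LinearMap.ker (μ.compr₂ φ)) =
        (Finset.univ.filter fun b => b ∈ LinearMap.ker (μ.compr₂ φ)).erase 0 by ext; simp,
        Finset.card_erase_of_mem (by simp), hcard, nsmul_eq_mul,
        Nat.cast_sub Finite.card_pos, Nat.cast_one]
  have hdouble : ∑ b : E with b ≠ 0,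
      ∑ φ : Dual F P with φ ≠ 0 ∧ φ ∈ (LinearMap.range (μ b)).dualAnnihilator,
        isotropicExcess μ φ = (Nat.card F - 1) * ∑ φ : Dual F P with φ ≠ 0,
          isotropicExcess μ φ := by
    have h : ∀ b : E,
        ∑ φ : Dual F P with φ ≠ 0 ∧ φ ∈ (LinearMap.range (μ b)).dualAnnihilator,
          isotropicExcess μ φ = ∑ φ : Dual F P with φ ≠ 0,
            if φ ∈ (LinearMap.range (μ b)).dualAnnihilator then isotropicExcess μ φ else 0 := by
      intro b
      rw [← Finset.filter_filter, Finset.sum_filter (fun φ => φ ∈ _)]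
    simp only [h]
    rw [Finset.sum_comm, Finset.mul_sum]
    exact Finset.sum_congr rfl fun φ hφ => hker_card φ (Finset.mem_filter.1 hφ).2
  rw [Finset.sum_congr rfl fun b hb' => hb b (Finset.mem_filter.1 hb').2, hall,
    Finset.sum_const, Finset.filter_ne', Finset.card_erase_of_mem (Finset.mem_univ _),
    Finset.card_univ, ← Nat.card_eq_fintype_card, nsmul_eq_mul, Nat.cast_sub Finite.card_pos,
    hE] at hdouble
  push_cast at hdouble
  apply mul_left_cancel₀ hq
  linear_combination hdouble

end DoubleCount

/-! ### Reduction to odd dimension and the numerical contradiction. -/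

section SymmetricProducts

variable {F E P : Type*} [Field F] [Finite F] [AddCommGroup E] [Module F E]
  [FiniteDimensional F E] [AddCommGroup P] [Module F P] [FiniteDimensional F P]

theorem exists_odd_finrank_sup_span_singleton_eq_top {K V : Type*} [Field K] [AddCommGroup V]
    [Module K V] [FiniteDimensional K V] [Nontrivial V] :
    ∃ (B : Submodule K V) (w : V), B ⊔ Submodule.span K {w} = ⊤ ∧
      (finrank K B = finrank K V ∨ finrank K B + 1 = finrank K V) ∧ Odd (finrank K B) := by
  rcases Nat.even_or_odd (finrank K V) with he | ho
  · obtain ⟨w, hw⟩ := exists_ne (0 : V)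
    obtain ⟨B, hB⟩ := (Submodule.span K {w}).exists_isCompl
    have h := Submodule.finrank_add_eq_of_isCompl hB
    rw [finrank_span_singleton hw] at h
    refine ⟨B, w, hB.symm.sup_eq_top, Or.inr (by omega), ?_⟩
    rwa [← h, add_comm, Nat.even_add_one, Nat.not_even_iff_odd] at he
  · exact ⟨⊤, 0, by simp, Or.inl (finrank_top K V), by rwa [finrank_top]⟩

-- Orthogonality to `w` is one linear condition on the radical of the restriction, and the vectors
-- satisfying it lie in the radical of `φ`.
omit [Finite F] in
theorem finrank_ker_domRestrict_le (φ : LinearMap.BilinForm F E)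
    (hker : finrank F (LinearMap.ker φ) ≤ 1) (B : Submodule F E) (w : E)
    (hw : B ⊔ Submodule.span F {w} = ⊤) :
    finrank F (LinearMap.ker (φ.domRestrict₁₂ B B)) ≤ 2 := by
  let K := LinearMap.ker (φ.domRestrict₁₂ B B)
  let ι : K →ₗ[F] E := B.subtype.comp K.subtype
  let g : K →ₗ[F] F := (φ.flip w).comp ι
  have hrange : finrank F (LinearMap.range g) ≤ 1 :=
    (Submodule.finrank_le _).trans (finrank_self F).le
  have hkg : finrank F (LinearMap.ker g) ≤ 1 := by
    refine le_trans ?_ hker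
    have hmem : ∀ x : LinearMap.ker g, (ι.comp (LinearMap.ker g).subtype) x ∈
        LinearMap.ker φ := by
      intro x
      rw [LinearMap.mem_ker]
      ext v
      obtain ⟨b, hb, c, hc, rfl⟩ := Submodule.mem_sup.1
        (hw ▸ Submodule.mem_top : v ∈ B ⊔ Submodule.span F {w})
      obtain ⟨t, rfl⟩ := Submodule.mem_span_singleton.1 hc
      have h1 : φ (ι x.1) b = 0 := LinearMap.congr_fun (LinearMap.mem_ker.1 x.1.2) ⟨b, hb⟩
      have h2 : φ (ι x.1) w = 0 := LinearMap.mem_ker.1 x.2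
      simp [h1, h2]
    refine LinearMap.finrank_le_finrank_of_injective
      (f := LinearMap.codRestrict (LinearMap.ker φ) (ι.comp (LinearMap.ker g).subtype) hmem) ?_
    intro x y hxy
    have h := congrArg Subtype.val hxy
    exact Subtype.ext (Subtype.ext (Subtype.ext h))
  have h := LinearMap.finrank_range_add_finrank_ker g
  change finrank F K ≤ 2
  omega

/-- There is no symmetric product `E × E → P` over a finite field with `dim P = 2 * dim E - 1` and
`3 ≤ dim E` without zero divisors, with `x * x ∈ b * E` only for `x` proportional to `b`, and all of
whose nonzero linear functionals have rank at least `dim E - 1`. -/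
theorem finrank_ne_of_symmetric_product (μ : E →ₗ[F] E →ₗ[F] P)
    (hsymm : ∀ x y, μ x y = μ y x)
    (hinj : ∀ a, a ≠ 0 → Function.Injective (μ a))
    (hsq : ∀ b x, x ∉ Submodule.span F {b} → ∀ c, μ x x ≠ μ b c)
    (hker : ∀ φ : Dual F P, φ ≠ 0 → finrank F (LinearMap.ker (μ.compr₂ φ)) ≤ 1)
    (hdim : 3 ≤ finrank F E) : finrank F P ≠ 2 * finrank F E - 1 := by
  intro hP
  have : Nontrivial E := finrank_pos_iff.1 (by omega : 0 < finrank F E)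
  obtain ⟨B, w, hw, hBdim, hodd⟩ := exists_odd_finrank_sup_span_singleton_eq_top (K := F) (V := E)
  obtain ⟨s, hs⟩ : ∃ s, finrank F P = finrank F B + s :=
    ⟨finrank F P - finrank F B, by omega⟩
  have h := isotropicExcess_double_count (μ.domRestrict₁₂ B B) (fun x y => hsymm x y)
    (fun a ha x y hxy => Subtype.ext (hinj a (by simpa using ha) hxy))
    (fun b x hx c => hsq b x (fun hx' => hx (by
      obtain ⟨t, ht⟩ := Submodule.mem_span_singleton.1 hx'
      exact Submodule.mem_span_singleton.2 ⟨t, Subtype.ext ht⟩)) c) hodd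
    (fun φ hφ => finrank_ker_domRestrict_le (μ.compr₂ φ) (hker φ hφ) B w hw) hs
  have hq : (2 : ℤ) ≤ Nat.card F := by
    have := Finite.one_lt_card (α := F)
    omega
  generalize (Nat.card F : ℤ) = q at h hq
  have hpos : ∀ n, 0 < q ^ n := fun n => pow_pos (by omega) n
  rcases hBdim with hB | hB
  -- Here `B` is everything and `s + 1 = dim B`, so the left side of the identity is zero and the
  -- right side is positive.
  · obtain ⟨r, hr⟩ : ∃ r, finrank F B = r + 2 := ⟨finrank F B - 2, by omega⟩
    have hsr : s = r + 1 := by omega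
    rw [hr, hsr] at h
    have h1 : (q - 1) * q ^ (r + 2) * (q ^ (r + 1) - 1) = 0 := by
      linear_combination -h
    have h2 : 1 < q ^ (r + 1) := one_lt_pow₀ (by omega) (by omega)
    have := mul_pos (mul_pos (by omega : 0 < q - 1) (hpos (r + 2))) (sub_pos.2 h2)
    omega
  -- Here `B` is a hyperplane and `s = dim B + 1`; the left side of the identity exceeds the right.
  · obtain ⟨r, hr⟩ : ∃ r, finrank F B = r + 2 := ⟨finrank F B - 2, by omega⟩
    have hsr : s = r + 3 := by omega
    rw [hr, hsr] at h
    have h1 : (q - 1) * q ^ (r + 2) * (q * (q ^ (r + 1) - 1)) = 0 := by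
      linear_combination h
    have h2 : 1 < q ^ (r + 1) := one_lt_pow₀ (by omega) (by omega)
    have := mul_pos (mul_pos (by omega : 0 < q - 1) (hpos (r + 2)))
      (mul_pos (by omega : 0 < q) (sub_pos.2 h2))
    omega

end SymmetricProducts

/-! ### Consequences of the Sidon condition. -/

section Sidon

variable {F L : Type*} [Field F] [Field L] [Algebra F L] {A : Submodule F L}

/-- Both `y * u` and `y * v` lie in `A ∩ yA`, which is at most a line. -/
theorem IsSidonSpace.exists_smul_eq (hA : IsSidonSpace A) {y u v : L}
    (hy : y ∉ Set.range (algebraMap F L)) (hu : u ∈ A) (hv : v ∈ A) (hyu : y * u ∈ A)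
    (hyv : y * v ∈ A) (hu0 : u ≠ 0) : ∃ t : F, t • u = v := by
  have hy0 : y ≠ 0 := by
    rintro rfl
    exact hy ⟨0, map_zero _⟩
  obtain ⟨w, hw⟩ := rank_le_one_iff.1 (hA y hy)
  obtain ⟨r, hr⟩ := hw ⟨y * u, hyu, u, hu, rfl⟩
  obtain ⟨s, hs⟩ := hw ⟨y * v, hyv, v, hv, rfl⟩
  have hr' : r • (w : L) = y * u := congrArg Subtype.val hr
  have hs' : s • (w : L) = y * v := congrArg Subtype.val hs
  have hr0 : r ≠ 0 := by
    rintro rfl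
    rw [zero_smul] at hr'
    exact mul_ne_zero hy0 hu0 hr'.symm
  refine ⟨s * r⁻¹, mul_left_cancel₀ hy0 ?_⟩
  rw [mul_smul_comm, ← hr', smul_smul, inv_mul_cancel_right₀ hr0, hs']

/-- The multiplication of `A` with values in the space `A * A`. -/
def Submodule.mulBilin (A : Submodule F L) : A →ₗ[F] A →ₗ[F] ↥(A * A) :=
  LinearMap.mk₂ F (fun x y => ⟨x * y, Submodule.mul_mem_mul x.2 y.2⟩)
    (fun _ _ _ => Subtype.ext (add_mul _ _ _)) (fun _ _ _ => Subtype.ext (smul_mul_assoc _ _ _))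
    (fun _ _ _ => Subtype.ext (mul_add _ _ _)) (fun _ _ _ => Subtype.ext (mul_smul_comm _ _ _))

instance Submodule.finiteDimensional_mul [FiniteDimensional F A] :
    FiniteDimensional F ↥(A * A) :=
  Module.Finite.iff_fg.2 ((Module.Finite.iff_fg.1 ‹_›).mul (Module.Finite.iff_fg.1 ‹_›))

theorem Submodule.mulBilin_injective {a : A} (ha : a ≠ 0) :
    Function.Injective (A.mulBilin a) := by
  intro x y hxy
  exact Subtype.ext (mul_left_cancel₀ (by simpa using ha) (congrArg Subtype.val hxy))

theorem div_mem_range_algebraMap_iff {a c : A} (ha : a ≠ 0) :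
    (c : L) / a ∈ Set.range (algebraMap F L) ↔ c ∈ Submodule.span F {a} := by
  have ha' : (a : L) ≠ 0 := by simpa using ha
  rw [Submodule.mem_span_singleton]
  refine exists_congr fun t => ?_
  rw [eq_div_iff ha', ← Algebra.smul_def]
  exact (Subtype.ext_iff (a1 := t • a) (a2 := c)).symm

/-- If `x² = bc`, then `y = x / b` carries `b` to `x` and `x` to `c`, both in `A`, so `b` and `x`
are proportional. -/
theorem IsSidonSpace.mulBilin_self_ne (hA : IsSidonSpace A) (b x : A)
    (hx : x ∉ Submodule.span F {b}) (c : A) : A.mulBilin x x ≠ A.mulBilin b c := by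
  intro h
  have h' : (x : L) * x = b * c := congrArg Subtype.val h
  have hx0 : (x : L) ≠ 0 := by
    rintro h0
    exact hx ((Subtype.ext h0 : x = 0) ▸ Submodule.zero_mem _)
  have hb0 : (b : L) ≠ 0 := by
    intro hb
    rw [hb, zero_mul] at h'
    exact mul_ne_zero hx0 hx0 h'
  have hb : b ≠ 0 := by simpa using hb0
  obtain ⟨t, ht⟩ := hA.exists_smul_eq (mt (div_mem_range_algebraMap_iff hb).1 hx) b.2 x.2
    (by rw [div_mul_cancel₀ _ hb0]; exact x.2)
    (by rw [div_mul_eq_mul_div, h', mul_div_cancel_left₀ _ hb0]; exact c.2) hb0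
  exact hx (Submodule.mem_span_singleton.2 ⟨t, Subtype.ext ht⟩)

/-- A common element `cu = ax` means that `c / a` carries `u` into `A`; all such `u` are
proportional. -/
theorem IsSidonSpace.finrank_inf_range_mulBilin_le [FiniteDimensional F A] (hA : IsSidonSpace A)
    {a c : A} (ha : a ≠ 0) (hc : c ∉ Submodule.span F {a}) :
    finrank F ↥(LinearMap.range (A.mulBilin a) ⊓ LinearMap.range (A.mulBilin c)) ≤ 1 := by
  have ha' : (a : L) ≠ 0 := by simpa using ha
  have hy := mt (div_mem_range_algebraMap_iff ha).1 hc
  by_cases h0 : ∃ p : ↥(LinearMap.range (A.mulBilin a) ⊓ LinearMap.range (A.mulBilin c)), p ≠ 0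
  · obtain ⟨⟨p, ⟨x, rfl⟩, ⟨u, hu⟩⟩, hp⟩ := h0
    refine finrank_le_one ⟨A.mulBilin a x, ⟨x, rfl⟩, ⟨u, hu⟩⟩ ?_
    rintro ⟨_, ⟨x', rfl⟩, ⟨u', hu'⟩⟩
    have h1 : (c : L) * u = a * x := congrArg Subtype.val hu
    have h2 : (c : L) * u' = a * x' := congrArg Subtype.val hu'
    have hu0 : (u : L) ≠ 0 := by
      intro h
      apply hp
      apply Subtype.ext
      apply Subtype.ext
      change (a : L) * x = 0
      rw [← h1, h, mul_zero]
    obtain ⟨t, ht⟩ := hA.exists_smul_eq hy u.2 u'.2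
      (by rw [div_mul_eq_mul_div, h1, mul_div_cancel_left₀ _ ha']; exact x.2)
      (by rw [div_mul_eq_mul_div, h2, mul_div_cancel_left₀ _ ha']; exact x'.2) hu0
    refine ⟨t, Subtype.ext (Subtype.ext ?_)⟩
    change t • ((a : L) * x) = a * x'
    rw [← h1, ← h2, ← ht, mul_smul_comm]
  · push Not at h0
    exact finrank_le_one 0 fun p => ⟨0, by rw [h0 p, smul_zero]⟩

theorem IsSidonSpace.le_finrank_sup_range_mulBilin [FiniteDimensional F A] (hA : IsSidonSpace A)
    {a c : A} (ha : a ≠ 0) (hc : c ∉ Submodule.span F {a}) :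
    2 * finrank F A - 1 ≤
      finrank F ↥(LinearMap.range (A.mulBilin a) ⊔ LinearMap.range (A.mulBilin c)) := by
  have hc0 : c ≠ 0 := by
    rintro rfl
    exact hc (Submodule.zero_mem _)
  have h := Submodule.finrank_sup_add_finrank_inf_eq (LinearMap.range (A.mulBilin a))
    (LinearMap.range (A.mulBilin c))
  rw [LinearMap.finrank_range_of_inj (Submodule.mulBilin_injective ha),
    LinearMap.finrank_range_of_inj (Submodule.mulBilin_injective hc0)] at h
  have := hA.finrank_inf_range_mulBilin_le ha hc
  omega

/-- For independent `a`, `c` in the radical, `φ` would vanish on `aA + cA`, which fills `A * A` by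
dimension. -/
theorem IsSidonSpace.finrank_ker_compr₂_le [FiniteDimensional F A] (hA : IsSidonSpace A)
    (hdim : finrank F ↥(A * A) ≤ 2 * finrank F A - 1) {φ : Dual F ↥(A * A)} (hφ : φ ≠ 0) :
    finrank F (LinearMap.ker (A.mulBilin.compr₂ φ)) ≤ 1 := by
  by_cases h0 : ∃ a : LinearMap.ker (A.mulBilin.compr₂ φ), a ≠ 0
  · obtain ⟨a, ha⟩ := h0
    refine finrank_le_one a fun c => ?_
    by_contra hc
    have hc' : (c : A) ∉ Submodule.span F {(a : A)} := by
      intro h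
      obtain ⟨t, ht⟩ := Submodule.mem_span_singleton.1 h
      exact hc ⟨t, Subtype.ext ht⟩
    have htop := Submodule.eq_top_of_finrank_eq (le_antisymm (Submodule.finrank_le _)
      (hdim.trans (hA.le_finrank_sup_range_mulBilin (by simpa using ha) hc')))
    have hle : ∀ b : LinearMap.ker (A.mulBilin.compr₂ φ),
        LinearMap.range (A.mulBilin b) ≤ LinearMap.ker φ := by
      rintro b _ ⟨x, rfl⟩
      exact LinearMap.congr_fun (LinearMap.mem_ker.1 b.2) x
    apply hφ
    rw [← LinearMap.ker_eq_top, ← top_le_iff, ← htop]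
    exact sup_le (hle a) (hle c)
  · push Not at h0
    exact finrank_le_one 0 fun p => ⟨0, by rw [h0 p, smul_zero]⟩

end Sidon

/-- Over a finite field, a Sidon space `A` of finite dimension at least `3` satisfies
`dim (A ^ 2) > 2 * dim A - 1`, where `A * A` is the linear span of the products `a * b`, `a b ∈ A`. -/
theorem mainTheorem3 {F L : Type*} [Field F] [Finite F] [Field L] [Algebra F L]
    (A : Submodule F L) [FiniteDimensional F A] (hA : IsSidonSpace A)
    (hdim : 3 ≤ Module.finrank F A) :
    Module.finrank F ↥(A * A) > 2 * Module.finrank F A - 1 := by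
  by_contra! hle
  have : Nontrivial A := Module.finrank_pos_iff.1 (by omega : 0 < Module.finrank F A)
  obtain ⟨a, ha⟩ := exists_ne (0 : A)
  obtain ⟨c, hc⟩ : ∃ c : A, c ∉ Submodule.span F {a} := by
    by_contra! h
    have := finrank_le_one a fun c => Submodule.mem_span_singleton.1 (h c)
    omega
  have hge := (hA.le_finrank_sup_range_mulBilin ha hc).trans (Submodule.finrank_le _)
  exact finrank_ne_of_symmetric_product A.mulBilin
    (fun x y => Subtype.ext (mul_comm _ _)) (fun _ => Submodule.mulBilin_injective)
    hA.mulBilin_self_ne (fun _ => hA.finrank_ker_compr₂_le hle) hdim (le_antisymm hle hge)
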